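/- Let $k$ be a field and $\mu\ge 0$ an integer. A set $\mathcal H$ of subsets ("faces") of $V=\{1,\dots,\mu\}$ is a separated hypergraph with vertex set $V$ if its faces cover $V$ and for all $j_1<j_2$ in $V$ there are faces $F_1,F_2\in\mathcal H$ with $j_1\in F_1\setminus F_2$ and $j_2\in F_2\setminus F_1$. A square-free monomial ideal $I$ of a polynomial ring $R=k[\mathcal A]$ (on any set $\mathcal A$ of variables) is associated to $\mathcal H$ if $I$ has a minimal monomial generating set $m_1,\dots,m_\mu$ such that a non-empty set $F\subseteq V$ is in $\mathcal H$ if and only if there is a variable $a\in\mathcal A$ with $F=\{j\in V : a\mid m_j\}$ (the empty face, which only records unused variables, is disregarded). For an $R$-module $M$ let $\beta_l(M)=\dim_k\operatorname{Tor}_l^R(M,k)$ be its $l$-th total Betti number, where $k=R/(\mathcal A)$. Let $\mathcal H$ be a separated hypergraph. If $I_1\subseteq R_1=k[\mathcal A_1]$ and $I_2\subseteq R_2=k[\mathcal A_2]$ are square-free monomial ideals associated to $\mathcal H$, then $\beta_l(I_1)=\beta_l(I_2)$ and $\beta_l(R_1/I_1)=\beta_l(R_2/I_2)$ for every $l\ge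 0$, and $\operatorname{pd}_{R_1}(R_1/I_1)=\operatorname{pd}_{R_2}(R_2/I_2)$. Consequently (for fixed $k$) $\operatorname{pd}(\mathcal H)$ is well defined: there is exactly one value $d$ such that $\operatorname{pd}_R(R/I)=d$ for every square-free monomial ideal $I\subseteq R=k[\mathcal A]$ associated to $\mathcal H$. -/

import Mathlib

open CategoryTheory MvPolynomial

universe u v u₁ u₂ w

/-- A set `H` of subsets (faces) of the vertex set `V = {1, …, μ}`, here `Fin μ`, is a hypergraph
with vertex set `V` if its faces cover `V`. -/
def IsHypergraph {μ : ℕ} (H : Set (Finset (Fin μ))) : Prop :=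
  ∀ j : Fin μ, ∃ F ∈ H, j ∈ F

/-- A hypergraph is separated if for any two distinct vertices there are a face that contains the
first but not the second and a face that contains the second but not the first. -/
def IsSeparatedHypergraph {μ : ℕ} (H : Set (Finset (Fin μ))) : Prop :=
  IsHypergraph H ∧
    ∀ j₁ j₂ : Fin μ, j₁ < j₂ →
      ∃ F₁ ∈ H, ∃ F₂ ∈ H, (j₁ ∈ F₁ ∧ j₁ ∉ F₂) ∧ (j₂ ∈ F₂ ∧ j₂ ∉ F₁)

/-- An ideal of `k[σ]` is a square-free monomial ideal if it is generated by a set of square-free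
monomials, i.e. of products of distinct variables. -/
def IsSquarefreeMonomialIdeal {k : Type v} [Field k] {σ : Type u}
    (I : Ideal (MvPolynomial σ k)) : Prop :=
  ∃ S : Set (MvPolynomial σ k), (∀ p ∈ S, ∃ s : Finset σ, p = ∏ a ∈ s, X a) ∧ I = Ideal.span S

/-- `m₁, …, m_μ` is a minimal monomial generating set of `I`: the `m_j` are monomials, they
generate `I`, and no `m_j` can be left out (in particular they are distinct). -/
def IsMinimalMonomialGenerators {k : Type v} [Field k] {σ : Type u} {μ : ℕ}
    (m : Fin μ → MvPolynomial σ k) (I : Ideal (MvPolynomial σ k)) : Prop :=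
  (∀ j, ∃ e : σ →₀ ℕ, m j = monomial e 1) ∧
    Ideal.span (Set.range m) = I ∧
    ∀ j, Ideal.span (m '' {i | i ≠ j}) ≠ I

/-- The hypergraph of `m₁, …, m_μ`: `F` is a face if and only if there is a variable `a` such
that, for every vertex `j`, `a` divides `m_j` if and only if `j ∈ F`. -/
def hypergraphOf {k : Type v} [Field k] {σ : Type u} {μ : ℕ}
    (m : Fin μ → MvPolynomial σ k) : Set (Finset (Fin μ)) :=
  {F | ∃ a : σ, ∀ j : Fin μ, (X a : MvPolynomial σ k) ∣ m j ↔ j ∈ F}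

/-- `I` is a square-free monomial ideal associated to the hypergraph `H`: for some numbering
`m₁, …, m_μ` of its minimal monomial generators, the hypergraph of `m₁, …, m_μ` is `H`.
The empty face is disregarded: it only records whether the polynomial ring has a variable that
divides none of the generators. -/
def IsAssociatedTo {k : Type v} [Field k] {σ : Type u} {μ : ℕ}
    (I : Ideal (MvPolynomial σ k)) (H : Set (Finset (Fin μ))) : Prop :=
  IsSquarefreeMonomialIdeal I ∧
    ∃ m : Fin μ → MvPolynomial σ k,
      IsMinimalMonomialGenerators m I ∧ hypergraphOf m \ {∅} = H \ {∅}

/-- The residue field `k = k[σ] / (all variables)` as a module over `k[σ]`. -/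
noncomputable def residueModule (k : Type v) [Field k] (σ : Type u) :
    ModuleCat.{max u v} (MvPolynomial σ k) :=
  ModuleCat.of (MvPolynomial σ k)
    (MvPolynomial σ k ⧸ (Ideal.span (Set.range X) : Ideal (MvPolynomial σ k)))

/-- The `l`-th total Betti number `dim_k Tor_l^R(M, k)` of a module `M` over `R = k[σ]`, as an
element of `ℕ ∪ {∞}`. Mathlib's `Tor'` is the `Tor` obtained by deriving the first factor; the
`k`-vector space structure is the restriction of the `R`-module structure to `k ⊆ R`. -/
noncomputable def totalBetti {k : Type v} [Field k] {σ : Type u} (l : ℕ)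
    (M : ModuleCat.{max u v} (MvPolynomial σ k)) : ℕ∞ :=
  Cardinal.toENat (Module.rank k
    ((ModuleCat.restrictScalars (algebraMap k (MvPolynomial σ k))).obj
      (((Tor' (ModuleCat.{max u v} (MvPolynomial σ k)) l).obj M).obj (residueModule k σ))))

/-- The `R`-module `R / I`. -/
noncomputable def quotientModule {k : Type v} [Field k] {σ : Type u}
    (I : Ideal (MvPolynomial σ k)) : ModuleCat.{max u v} (MvPolynomial σ k) :=
  ModuleCat.of (MvPolynomial σ k) (MvPolynomial σ k ⧸ I)

/-- The ideal `I`, as an `R`-module. -/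
noncomputable def idealModule {k : Type v} [Field k] {σ : Type u}
    (I : Ideal (MvPolynomial σ k)) : ModuleCat.{max u v} (MvPolynomial σ k) :=
  ModuleCat.of (MvPolynomial σ k) I

/-!
Let `S` be the polynomial ring with one variable `X_F` for each nonempty face `F` of `H`, and let
`J ⊆ S` be generated by the monomials `∏_{F ∋ j} X_F`, one for each vertex `j`. If `I ⊆ R = k[σ]` is
associated to `H`, then `I` is the extension of `J` along the substitution `S → R` that sends `X_F`
to the product of the variables with face `F`. These products involve disjoint nonempty sets of
variables, so the monomials that none of them divides form a basis of `R` over `S`. The substitution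
is therefore faithfully flat and, as it is compatible with the augmentations to `k`, it preserves
`Tor(-, k)` as well as projective dimensions. All invariants of `I` are thus those of `J`, which
depends only on `H`.
-/

section HomologicalAlgebra

variable {C : Type*} {D : Type*} {E : Type*} [Category* C] [Category* D] [Category* E]
  [Abelian C] [Abelian D] [Abelian E]

section ProjectiveDimension

variable [EnoughProjectives C] (F : C ⥤ D) [F.Additive] [F.PreservesHomology]
  [F.PreservesProjectiveObjects] [F.Faithful]

theorem hasProjectiveDimensionLT_obj_iff (hF : ∀ X, Projective (F.obj X) → Projective X)
    (X : C) (n : ℕ) : HasProjectiveDimensionLT (F.obj X) n ↔ HasProjectiveDimensionLT X n := by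
  induction n generalizing X with
  | zero =>
    rw [hasProjectiveDimensionLT_zero_iff_isZero, hasProjectiveDimensionLT_zero_iff_isZero]
    exact ⟨fun h => (Limits.IsZero.iff_id_eq_zero X).2 (F.map_injective (h.eq_of_src _ _)),
      F.map_isZero⟩
  | succ n ih =>
    rcases n with _ | n
    · rw [zero_add, ← projective_iff_hasProjectiveDimensionLT_one,
        ← projective_iff_hasProjectiveDimensionLT_one]
      exact ⟨hF X, fun _ => F.projective_obj X⟩
    · have := F.preservesFiniteLimits_of_preservesHomology
      have := F.preservesFiniteColimits_of_preservesHomology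
      obtain ⟨⟨P, π⟩⟩ := EnoughProjectives.presentation X
      let T := ShortComplex.mk (Limits.kernel.ι π) π (Limits.kernel.condition π)
      have hT : T.ShortExact := { exact := ShortComplex.exact_kernel π }
      have hFT : (T.map F).ShortExact := hT.map_of_exact F
      have hFP : Projective (T.map F).X₂ := F.projective_obj P
      exact ((hFT.hasProjectiveDimensionLT_X₃_iff n hFP).trans (ih _)).trans
        (hT.hasProjectiveDimensionLT_X₃_iff n ‹_›).symm

theorem projectiveDimension_obj (hF : ∀ X, Projective (F.obj X) → Projective X) (X : C) :
    projectiveDimension (F.obj X) = projectiveDimension X := by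
  simp only [projectiveDimension, hasProjectiveDimensionLT_obj_iff F hF]

end ProjectiveDimension

/-- Exact functors commute with left derived functors: `Lₙ(F ⋙ G) ≅ Lₙ F ⋙ G` at an object, for `G`
exact. -/
noncomputable def leftDerivedObjCompIso [HasProjectiveResolutions C] (F : C ⥤ D) [F.Additive]
    (G : D ⥤ E) [G.Additive] [G.PreservesHomology] (n : ℕ) (X : C) :
    ((F ⋙ G).leftDerived n).obj X ≅ G.obj ((F.leftDerived n).obj X) :=
  let P := projectiveResolution X
  P.isoLeftDerivedObj (F ⋙ G) n ≪≫
    (((F.mapHomologicalComplex _).obj P.complex).sc n).mapHomologyIso G ≪≫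
      G.mapIso (P.isoLeftDerivedObj F n).symm

/-- Change of source along an exact functor `F` that preserves projectives: such a functor maps a
projective resolution of `X` to one of `F X`, so `Lₙ G` at `F X` is `Lₙ(F ⋙ G)` at `X`. -/
noncomputable def leftDerivedObjIso [HasProjectiveResolutions C] [HasProjectiveResolutions D]
    (F : C ⥤ D) [F.Additive] [F.PreservesHomology] [F.PreservesProjectiveObjects]
    (G : D ⥤ E) [G.Additive] (n : ℕ) (X : C) :
    (G.leftDerived n).obj (F.obj X) ≅ ((F ⋙ G).leftDerived n).obj X :=
  let P := projectiveResolution X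
  (F.mapProjectiveResolution P).isoLeftDerivedObj G n ≪≫ (P.isoLeftDerivedObj (F ⋙ G) n).symm

/-- The isomorphism of left derived functors induced by an isomorphism of functors. -/
noncomputable def leftDerivedIso [HasProjectiveResolutions C] {F G : C ⥤ D} [F.Additive]
    [G.Additive] (e : F ≅ G) (n : ℕ) : F.leftDerived n ≅ G.leftDerived n where
  hom := NatTrans.leftDerived e.hom n
  inv := NatTrans.leftDerived e.inv n
  hom_inv_id := by rw [← NatTrans.leftDerived_comp, e.hom_inv_id, NatTrans.leftDerived_id]
  inv_hom_id := by rw [← NatTrans.leftDerived_comp, e.inv_hom_id, NatTrans.leftDerived_id]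

end HomologicalAlgebra

open scoped TensorProduct

section ExtensionOfScalars

variable {S : Type v} {R : Type u} [CommRing S] [CommRing R] (f : S →+* R)

instance additive_extendScalars : (ModuleCat.extendScalars.{v, u, v} f).Additive where
  map_add {M N g h} := by
    let := f.toAlgebra
    ext m
    exact TensorProduct.tmul_add _ _ _

instance preservesProjectiveObjects_extendScalars :
    (ModuleCat.extendScalars.{v, u, v} f).PreservesProjectiveObjects where
  projective_obj {M} hM := by
    let := f.toAlgebra
    rw [← IsProjective.iff_projective] at hM ⊢
    exact inferInstanceAs (Module.Projective R (R ⊗[S] M))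

variable {f}

theorem preservesHomology_extendScalars (hf : f.Flat) :
    (ModuleCat.extendScalars.{v, u, v} f).PreservesHomology := by
  let := f.toAlgebra
  have : Module.Flat S R := hf
  apply Functor.preservesHomology_of_map_exact
  intro T hT
  rw [ShortComplex.ShortExact.moduleCat_exact_iff_function_exact] at hT ⊢
  exact Module.Flat.lTensor_exact R hT

theorem faithful_extendScalars (hf : f.FaithfullyFlat) :
    (ModuleCat.extendScalars.{v, u, v} f).Faithful where
  map_injective {M N g h} hgh := by
    let := f.toAlgebra
    have : Module.FaithfullyFlat S R := hf
    ext : 1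
    have heq : g.hom.lTensor R = h.hom.lTensor R :=
      LinearMap.ext fun x => LinearMap.congr_fun (congrArg ModuleCat.Hom.hom hgh) x
    exact sub_eq_zero.1 ((Module.FaithfullyFlat.zero_iff_lTensor_zero S R _).2
      ((LinearMap.lTensor_sub _ _).trans (sub_eq_zero.2 heq)))

/-- A ring homomorphism is free if it makes its target a free module over its source. -/
def IsFreeRingHom (f : S →+* R) : Prop :=
  letI := f.toAlgebra
  Module.Free S R

theorem IsFreeRingHom.flat (hf : IsFreeRingHom f) : f.Flat :=
  letI := f.toAlgebra
  haveI : Module.Free S R := hf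
  inferInstanceAs (Module.Flat S R)

theorem IsFreeRingHom.faithfullyFlat [Nontrivial R] (hf : IsFreeRingHom f) : f.FaithfullyFlat :=
  letI := f.toAlgebra
  haveI : Module.Free S R := hf
  inferInstanceAs (Module.FaithfullyFlat S R)

theorem projective_restrictScalars [Algebra S R] [Module.Free S R] (P : Type*) [AddCommGroup P]
    [Module R P] [Module S P] [IsScalarTower S R P] [Module.Projective R P] :
    Module.Projective S P := by
  obtain ⟨s, hs⟩ := (Module.projective_def' (R := R) (P := P)).1 inferInstance
  exact .of_split (s.restrictScalars S) ((Finsupp.linearCombination R id).restrictScalars S)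
    (LinearMap.ext fun x => LinearMap.congr_fun hs x)

theorem projective_of_projective_tensorProduct [Nontrivial R] [Algebra S R] [Module.Free S R]
    (M : Type*) [AddCommGroup M] [Module S M] [Module.Projective R (R ⊗[S] M)] :
    Module.Projective S M := by
  have : Module.Projective S (R ⊗[S] M) := projective_restrictScalars (R := R) _
  let b := Module.Free.chooseBasis S R
  obtain ⟨i⟩ : Nonempty (Module.Free.ChooseBasisIndex S R) := inferInstance
  -- The basis vector `b i` exhibits `M` as a retract of `R ⊗ M`.
  refine Module.Projective.of_split (TensorProduct.mk S R M (b i))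
    (TensorProduct.lid S M ∘ₗ (b.coord i).rTensor M) ?_
  ext m
  simp

theorem projective_of_projective_extendScalars [Nontrivial R] (hf : IsFreeRingHom f)
    (M : ModuleCat.{v} S) (h : Projective ((ModuleCat.extendScalars.{v, u, v} f).obj M)) :
    Projective M := by
  let := f.toAlgebra
  have : Module.Free S R := hf
  rw [← IsProjective.iff_projective] at h ⊢
  have : Module.Projective R (R ⊗[S] M) := h
  exact projective_of_projective_tensorProduct (R := R) M

end ExtensionOfScalars

section TorBaseChange

section Tensor

variable {S R : Type*} [CommRing S] [CommRing R] [Algebra S R]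
  {κ κ' : Type*} [AddCommGroup κ] [Module S κ] [AddCommGroup κ'] [Module S κ'] [Module R κ']
  [IsScalarTower S R κ']

/-- The `S`-linear isomorphism `(R ⊗ M) ⊗ κ' ≃ M ⊗ κ` over `R` and `S`, for `κ' ≃ κ`. -/
noncomputable def baseChangeTensorEquiv (ε : κ' ≃ₗ[S] κ) (M : Type*) [AddCommGroup M]
    [Module S M] : (R ⊗[S] M) ⊗[R] κ' ≃ₗ[S] M ⊗[S] κ :=
  (TensorProduct.comm R (R ⊗[S] M) κ').restrictScalars S ≪≫ₗ
    (TensorProduct.AlgebraTensorModule.cancelBaseChange S R R κ' M).restrictScalars S ≪≫ₗ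
      TensorProduct.comm S κ' M ≪≫ₗ TensorProduct.congr (LinearEquiv.refl S M) ε

theorem baseChangeTensorEquiv_naturality (ε : κ' ≃ₗ[S] κ) {M N : Type*} [AddCommGroup M]
    [Module S M] [AddCommGroup N] [Module S N] (g : M →ₗ[S] N) (x : (R ⊗[S] M) ⊗[R] κ') :
    baseChangeTensorEquiv ε N ((g.baseChange R).rTensor κ' x) =
      g.rTensor κ (baseChangeTensorEquiv ε M x) := by
  induction x with
  | zero => simp
  | add x y hx hy => simp only [map_add, hx, hy]
  | tmul y z =>
    induction y with
    | zero => simp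
    | add y y' hy hy' => simp only [TensorProduct.add_tmul, map_add, hy, hy']
    | tmul r m => simp [baseChangeTensorEquiv]

end Tensor

variable {A : Type w} {S : Type v} {R : Type (max u v)} [CommRing A] [CommRing S] [CommRing R]
  (g : A →+* S) (f : S →+* R) {κ : ModuleCat.{v} S} {κ' : ModuleCat.{max u v} R}

open MonoidalCategory

/-- `baseChangeTensorEquiv` as an isomorphism of functors to `A`-modules. The base ring `A` maps to
`S` and `R`; the universe lift is there because `M ⊗ κ` lives in a smaller universe than
`(R ⊗ M) ⊗ κ'`. -/
noncomputable def extendScalarsTensorIso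
    (ε : (ModuleCat.restrictScalars f).obj κ' ≃ₗ[S] κ) :
    ModuleCat.extendScalars.{v, max u v, v} f ⋙ (tensoringRight _).obj κ' ⋙
        ModuleCat.restrictScalars (f.comp g) ≅
      (tensoringRight _).obj κ ⋙ ModuleCat.restrictScalars g ⋙ ModuleCat.uliftFunctor.{u} A :=
  letI := f.toAlgebra
  letI := Module.compHom κ' f
  haveI : IsScalarTower S R κ' := ⟨fun s r x => mul_smul (f s) r x⟩
  letI ε' : κ' ≃ₗ[S] κ := ε
  letI e (M : ModuleCat.{v} S) :
      (ModuleCat.restrictScalars (f.comp g)).obj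
        ((ModuleCat.extendScalars.{v, max u v, v} f).obj M ⊗ κ') ≃ₗ[A]
          ULift.{u} ((ModuleCat.restrictScalars g).obj (M ⊗ κ)) :=
    { (baseChangeTensorEquiv (R := R) ε' M).toAddEquiv.trans AddEquiv.ulift.symm with
      map_smul' a x := ULift.ext _ _ ((baseChangeTensorEquiv (R := R) ε' M).map_smul (g a) x) }
  NatIso.ofComponents (fun M => (e M).toModuleIso) fun h => by
    ext x
    exact ULift.ext _ _ (baseChangeTensorEquiv_naturality ε' h.hom x)

/-- Flat base change for Tor: `Tor_l^R(R ⊗ M, κ') ≅ Tor_l^S(M, κ)` as modules over a base ring `A`,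
for `R` flat over `S` and `κ' ≃ κ`. -/
noncomputable def torExtendScalarsIso (hf : f.Flat)
    (ε : (ModuleCat.restrictScalars f).obj κ' ≃ₗ[S] κ) (M : ModuleCat.{v} S) (l : ℕ) :
    (ModuleCat.restrictScalars (f.comp g)).obj
        (((Tor' (ModuleCat.{max u v} R) l).obj
          ((ModuleCat.extendScalars.{v, max u v, v} f).obj M)).obj κ') ≅
      (ModuleCat.uliftFunctor.{u} A).obj
        ((ModuleCat.restrictScalars g).obj (((Tor' (ModuleCat.{v} S) l).obj M).obj κ)) :=
  haveI := preservesHomology_extendScalars hf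
  letI F := ModuleCat.extendScalars.{v, max u v, v} f
  letI T' := (tensoringRight (ModuleCat.{max u v} R)).obj κ'
  letI T := (tensoringRight (ModuleCat.{v} S)).obj κ
  letI ρ' := ModuleCat.restrictScalars.{max u v} (f.comp g)
  (leftDerivedObjCompIso T' ρ' l (F.obj M)).symm ≪≫ leftDerivedObjIso F (T' ⋙ ρ') l M ≪≫
    (leftDerivedIso (extendScalarsTensorIso g f ε) l).app M ≪≫
      leftDerivedObjCompIso T (ModuleCat.restrictScalars g ⋙ ModuleCat.uliftFunctor.{u} A) l M

end TorBaseChange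

section IdealBaseChange

variable {S : Type v} {R : Type (max u v)} [CommRing S] [CommRing R] {f : S →+* R}

theorem nonempty_extendScalars_quotient_iso (J : Ideal S) :
    Nonempty ((ModuleCat.extendScalars.{v, max u v, v} f).obj (ModuleCat.of S (S ⧸ J)) ≅
      ModuleCat.of R (R ⧸ J.map f)) :=
  letI := f.toAlgebra
  ⟨(Algebra.TensorProduct.quotIdealMapEquivTensorQuot R J).symm.toLinearEquiv.toModuleIso⟩

theorem nonempty_extendScalars_ideal_iso (hf : f.Flat) (J : Ideal S) :
    Nonempty ((ModuleCat.extendScalars.{v, max u v, v} f).obj (ModuleCat.of S J) ≅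
      ModuleCat.of R (J.map f)) := by
  let := f.toAlgebra
  have : Module.Flat S R := hf
  let g : R ⊗[S] J →ₗ[R] R :=
    (TensorProduct.AlgebraTensorModule.rid S R R).toLinearMap ∘ₗ J.subtype.baseChange R
  have g_tmul (r : R) (j : J) : g (r ⊗ₜ j) = r * f j := mul_comm _ _
  have hg : Function.Injective g :=
    (TensorProduct.AlgebraTensorModule.rid S R R).injective.comp
      (Module.Flat.lTensor_preserves_injective_linearMap _ J.subtype_injective)
  have hrange : LinearMap.range g = J.map f := by
    refine le_antisymm ?_ (Ideal.span_le.2 ?_)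
    · rintro _ ⟨x, rfl⟩
      induction x with
      | zero => simp
      | add x y hx hy => rw [map_add]; exact Ideal.add_mem _ hx hy
      | tmul r j =>
        rw [g_tmul]
        exact Ideal.mul_mem_left _ _ (Ideal.mem_map_of_mem f j.2)
    · rintro _ ⟨j, hj, rfl⟩
      exact ⟨1 ⊗ₜ ⟨j, hj⟩, by rw [g_tmul, one_mul]⟩
  exact ⟨(LinearEquiv.ofInjective g hg ≪≫ₗ LinearEquiv.ofEq _ _ hrange).toModuleIso⟩

end IdealBaseChange

section PolynomialRings

variable {k : Type w} [Field k] {σ : Type u} {τ : Type}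

theorem totalBetti_congr {M N : ModuleCat.{max u w} (MvPolynomial σ k)} (e : M ≅ N) (l : ℕ) :
    totalBetti l M = totalBetti l N :=
  congrArg Cardinal.toENat (((ModuleCat.restrictScalars (algebraMap k (MvPolynomial σ k))).mapIso
    (((Tor' _ l).mapIso e).app (residueModule k σ))).toLinearEquiv.rank_eq)

theorem mem_span_range_X_iff {R : Type*} [CommRing R] {p : MvPolynomial σ R} :
    p ∈ Ideal.span (Set.range (X : σ → MvPolynomial σ R)) ↔ constantCoeff p = 0 := by
  have h := mem_pow_idealOfVars_iff' 1 p
  rw [pow_one] at h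
  simp only [Nat.lt_one_iff, Finsupp.degree_eq_zero_iff, forall_eq] at h
  exact h

variable {f : MvPolynomial τ k →ₐ[k] MvPolynomial σ k}

theorem nonempty_residueModule_equiv (hf : ∀ p, constantCoeff (f p) = constantCoeff p) :
    Nonempty ((ModuleCat.restrictScalars f.toRingHom).obj (residueModule k σ)
      ≃ₗ[MvPolynomial τ k] residueModule k τ) := by
  let := f.toRingHom.toAlgebra
  let L := Algebra.linearMap (MvPolynomial τ k)
    (MvPolynomial σ k ⧸ (Ideal.span (Set.range X) : Ideal (MvPolynomial σ k)))
  have hL (p) : L p = Ideal.Quotient.mk _ (f p) := rfl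
  have hker : LinearMap.ker L = Ideal.span (Set.range X) := by
    ext p
    rw [LinearMap.mem_ker, hL, Ideal.Quotient.eq_zero_iff_mem, mem_span_range_X_iff, hf]
    exact mem_span_range_X_iff.symm
  have hsurj : Function.Surjective L := by
    intro x
    obtain ⟨p, rfl⟩ := Ideal.Quotient.mk_surjective x
    refine ⟨C (constantCoeff p), ?_⟩
    rw [hL, Ideal.Quotient.eq, mem_span_range_X_iff, map_sub, hf, constantCoeff_C, sub_self]
  exact ⟨(L.quotKerEquivOfSurjective hsurj).symm ≪≫ₗ Submodule.quotEquivOfEq _ _ hker⟩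

theorem totalBetti_extendScalars (hflat : f.toRingHom.Flat)
    (hf : ∀ p, constantCoeff (f p) = constantCoeff p) (M : ModuleCat.{w} (MvPolynomial τ k))
    (l : ℕ) :
    totalBetti l ((ModuleCat.extendScalars.{w, max u w, w} f.toRingHom).obj M) =
      totalBetti l M := by
  obtain ⟨ε⟩ := nonempty_residueModule_equiv hf
  have hk : f.toRingHom.comp (algebraMap k _) = algebraMap k _ := f.comp_algebraMap
  let e := (torExtendScalarsIso (algebraMap k _) _ hflat ε M l).toLinearEquiv ≪≫ₗ
    ULift.moduleEquiv
  rw [totalBetti, totalBetti, ← hk]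
  simpa only [Cardinal.toENat_lift] using congrArg Cardinal.toENat e.lift_rank_eq

end PolynomialRings

open scoped Function

section MonoidAlgebra

theorem isFreeRingHom_mapDomainRingHom {k : Type w} [CommRing k] {M : Type u₁} {N : Type u₂}
    [AddCommMonoid M] [AddCommMonoid N] (φ : M →+ N) (B : Set N)
    (h : Function.Bijective fun x : B × M => (x.1 : N) + φ x.2) :
    IsFreeRingHom (AddMonoidAlgebra.mapDomainRingHom k φ) := by
  let := (AddMonoidAlgebra.mapDomainRingHom k φ).toAlgebra
  let L := Finsupp.linearCombination (AddMonoidAlgebra k M)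
    fun b : B => AddMonoidAlgebra.single (b : N) (1 : k)
  let E : (B →₀ AddMonoidAlgebra k M) ≃+ AddMonoidAlgebra k N :=
    (Finsupp.mapRange.addEquiv AddMonoidAlgebra.coeffAddEquiv).trans <|
      Finsupp.curryAddEquiv.symm.trans <|
        (Finsupp.domCongr (Equiv.ofBijective _ h)).trans AddMonoidAlgebra.coeffAddEquiv.symm
  have hLE : L.toAddMonoidHom = E := by
    ext b m c : 3
    have hsmul : AddMonoidAlgebra.single m c • AddMonoidAlgebra.single (b : N) (1 : k) =
        AddMonoidAlgebra.single (b + φ m) c := by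
      change AddMonoidAlgebra.mapDomain φ _ * _ = _
      rw [AddMonoidAlgebra.mapDomain_single, AddMonoidAlgebra.single_mul_single, mul_one, add_comm]
    simp [L, E, hsmul]
  have hL : Function.Bijective L := by
    have : ⇑L = E := funext (DFunLike.congr_fun hLE)
    exact this ▸ E.bijective
  exact Module.Free.of_equiv (LinearEquiv.ofBijective L hL)

end MonoidAlgebra

section Blocks

variable {σ : Type u} {τ : Type v} (s : τ → Finset σ)

/-- The map on exponents given by the substitution `X t ↦ ∏ a ∈ s t, X a`. -/
noncomputable def blockExponent : (τ →₀ ℕ) →ₗ[ℕ] (σ →₀ ℕ) :=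
  Finsupp.linearCombination ℕ fun t => ∑ a ∈ s t, Finsupp.single a 1

variable {s}

theorem blockExponent_apply_of_mem (hs : Pairwise (Disjoint on s)) {a : σ} {t : τ}
    (ha : a ∈ s t) (f : τ →₀ ℕ) : blockExponent s f a = f t := by
  classical
  have hmem (t') : a ∈ s t' ↔ t' = t :=
    ⟨fun h => by_contra fun hne => Finset.disjoint_left.1 (hs hne) h ha, fun h => h ▸ ha⟩
  simp [blockExponent, Finsupp.linearCombination_apply, Finsupp.sum_apply, Finsupp.single_apply,
    hmem, eq_comm]

theorem blockExponent_apply_of_forall_notMem {a : σ} (ha : ∀ t, a ∉ s t) (f : τ →₀ ℕ) :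
    blockExponent s f a = 0 := by
  classical
  simp [blockExponent, Finsupp.linearCombination_apply, Finsupp.sum_apply, Finsupp.single_apply,
    ha]

/-- The exponents of the monomials that no `∏ a ∈ s t, X a` divides. For disjoint nonempty `s t`
these monomials are a basis of `k[σ]` over `k[τ]`. -/
def reducedExponents (s : τ → Finset σ) : Set (σ →₀ ℕ) :=
  {r | ∀ t, ∃ a ∈ s t, r a = 0}

theorem le_of_add_blockExponent_eq (hs : Pairwise (Disjoint on s)) {r r' : σ →₀ ℕ}
    {f f' : τ →₀ ℕ} (hr : r ∈ reducedExponents s)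
    (h : r + blockExponent s f = r' + blockExponent s f') : f' ≤ f := by
  intro t
  obtain ⟨a, ha, hra⟩ := hr t
  have hat := DFunLike.congr_fun h a
  rw [Finsupp.add_apply, Finsupp.add_apply, blockExponent_apply_of_mem hs ha,
    blockExponent_apply_of_mem hs ha, hra] at hat
  lia

theorem exists_add_blockExponent_eq (hs : Pairwise (Disjoint on s)) (hne : ∀ t, (s t).Nonempty)
    (e : σ →₀ ℕ) : ∃ r ∈ reducedExponents s, ∃ f, r + blockExponent s f = e := by
  choose c hc using hne
  have hcinj : Function.Injective c := fun t t' h =>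
    by_contra fun htt' => Finset.disjoint_left.1 (hs htt') (hc t) (h ▸ hc t')
  let f : τ →₀ ℕ := Finsupp.onFinset (e.support.preimage c hcinj.injOn)
    (fun t => (s t).inf' ⟨c t, hc t⟩ e) fun t ht => by
      rw [Finset.mem_preimage, Finsupp.mem_support_iff]
      exact fun h0 => ht (Nat.le_zero.1 (h0 ▸ Finset.inf'_le e (hc t)))
  have hle : blockExponent s f ≤ e := fun a => by
    by_cases ha : ∃ t, a ∈ s t
    · obtain ⟨t, ha⟩ := ha
      exact (blockExponent_apply_of_mem hs ha f).trans_le (Finset.inf'_le e ha)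
    · rw [blockExponent_apply_of_forall_notMem (not_exists.1 ha)]
      exact Nat.zero_le _
  refine ⟨e - blockExponent s f, fun t => ?_, f, tsub_add_cancel_of_le hle⟩
  obtain ⟨a, ha, hmin⟩ := Finset.exists_mem_eq_inf' ⟨c t, hc t⟩ e
  refine ⟨a, ha, ?_⟩
  rw [Finsupp.tsub_apply, blockExponent_apply_of_mem hs ha]
  exact Nat.sub_eq_zero_of_le hmin.ge

theorem bijective_add_blockExponent (hs : Pairwise (Disjoint on s))
    (hne : ∀ t, (s t).Nonempty) :
    Function.Bijective fun x : reducedExponents s × (τ →₀ ℕ) =>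
      (x.1 : σ →₀ ℕ) + blockExponent s x.2 := by
  refine ⟨fun ⟨r, f⟩ ⟨r', f'⟩ h => ?_, fun e => ?_⟩
  · obtain rfl : f = f' := le_antisymm (le_of_add_blockExponent_eq hs r'.2 h.symm)
      (le_of_add_blockExponent_eq hs r.2 h)
    exact Prod.ext (Subtype.ext (add_right_cancel h)) rfl
  · obtain ⟨r, hr, f, h⟩ := exists_add_blockExponent_eq hs hne e
    exact ⟨(⟨r, hr⟩, f), h⟩

variable (k : Type w) [CommRing k] (s)

/-- The substitution `X t ↦ ∏ a ∈ s t, X a`. -/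
noncomputable def blockHom : MvPolynomial τ k →ₐ[k] MvPolynomial σ k :=
  aeval fun t => ∏ a ∈ s t, X a

@[simp]
theorem blockHom_X (t : τ) : blockHom s k (X t) = ∏ a ∈ s t, X a :=
  aeval_X _ t

variable {s k}

theorem constantCoeff_blockHom (hne : ∀ t, (s t).Nonempty) (p : MvPolynomial τ k) :
    constantCoeff (blockHom s k p) = constantCoeff p := by
  suffices h : constantCoeff.comp (blockHom s k).toRingHom = constantCoeff from
    RingHom.congr_fun h p
  ext t
  · simp
  · simpa using zero_pow (M₀ := k) (hne t).card_ne_zero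

theorem blockHom_eq_mapDomainRingHom :
    (blockHom s k).toRingHom =
      AddMonoidAlgebra.mapDomainRingHom k (blockExponent s).toAddMonoidHom := by
  have h_monomial (f : τ →₀ ℕ) (c : k) :
      AddMonoidAlgebra.mapDomainRingHom k (blockExponent s).toAddMonoidHom (monomial f c) =
        monomial (blockExponent s f) c :=
    AddMonoidAlgebra.mapDomain_single
  refine ringHom_ext (fun c => ?_) fun t => ?_
  · rw [C_apply, h_monomial, map_zero]
    exact (blockHom s k).commutes c
  · rw [X, h_monomial, blockExponent, Finsupp.linearCombination_single, one_smul, monomial_sum_one]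
    exact blockHom_X s k t

theorem isFreeRingHom_blockHom (hs : Pairwise (Disjoint on s))
    (hne : ∀ t, (s t).Nonempty) : IsFreeRingHom (blockHom s k).toRingHom := by
  rw [blockHom_eq_mapDomainRingHom]
  exact isFreeRingHom_mapDomainRingHom _ _ (bijective_add_blockExponent hs hne)

end Blocks

section SquarefreeMonomials

variable {σ : Type u} {k : Type w} [CommRing k]

theorem prod_X_eq_monomial (s : Finset σ) :
    ∏ a ∈ s, (X a : MvPolynomial σ k) = monomial (∑ a ∈ s, Finsupp.single a 1) 1 :=
  (monomial_sum_one s _).symm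

variable [Nontrivial k]

theorem X_dvd_prod_X_iff {a : σ} {s : Finset σ} :
    (X a : MvPolynomial σ k) ∣ ∏ b ∈ s, X b ↔ a ∈ s := by
  classical
  rw [prod_X_eq_monomial, X_dvd_monomial]
  simp [Finsupp.finsetSum_apply, Finsupp.single_apply]

theorem monomial_mem_span_iff {S : Set (MvPolynomial σ k)} (hS : ∀ p ∈ S, ∃ e, p = monomial e 1)
    {e : σ →₀ ℕ} :
    monomial e 1 ∈ Ideal.span S ↔ ∃ p ∈ S, p ∣ monomial e 1 := by
  refine ⟨fun h => ?_, fun ⟨p, hp, hdvd⟩ => Ideal.mem_of_dvd _ hdvd (Ideal.subset_span hp)⟩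
  obtain ⟨E, rfl⟩ := Set.subset_range_iff_exists_image_eq.1 fun p hp =>
    (hS p hp).imp fun _ => Eq.symm
  rw [mem_ideal_span_monomial_image] at h
  classical
  obtain ⟨e', he', hle⟩ := h e (by simp [support_monomial])
  exact ⟨_, ⟨e', he', rfl⟩, monomial_dvd_monomial.2 ⟨.inr hle, dvd_rfl⟩⟩

theorem eq_of_dvd_of_span_image_ne {R ι : Type*} [CommRing R] {m : ι → R} {i j : ι}
    (hj : Ideal.span (m '' {i | i ≠ j}) ≠ Ideal.span (Set.range m)) (h : m i ∣ m j) : i = j := by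
  by_contra hij
  refine hj (le_antisymm (Ideal.span_mono (Set.image_subset_range _ _)) (Ideal.span_le.2 ?_))
  rintro _ ⟨l, rfl⟩
  obtain rfl | hl := eq_or_ne l j
  · exact Ideal.mem_of_dvd _ h (Ideal.subset_span ⟨i, hij, rfl⟩)
  · exact Ideal.subset_span ⟨l, hl, rfl⟩

end SquarefreeMonomials

section AssociatedIdeals

variable {k : Type w} [Field k] {σ : Type u} {μ : ℕ}

theorem IsMinimalMonomialGenerators.exists_eq_prod_X {I : Ideal (MvPolynomial σ k)}
    {m : Fin μ → MvPolynomial σ k} (hm : IsMinimalMonomialGenerators m I)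
    (hI : IsSquarefreeMonomialIdeal I) (j : Fin μ) : ∃ s : Finset σ, m j = ∏ a ∈ s, X a := by
  obtain ⟨hmon, rfl, hmin⟩ := hm
  obtain ⟨S, hS, hspan⟩ := hI
  have hS' (p) (hp : p ∈ S) : ∃ e, p = monomial e 1 := by
    obtain ⟨s, rfl⟩ := hS p hp
    exact ⟨_, prod_X_eq_monomial s⟩
  obtain ⟨e, he⟩ := hmon j
  have hmj : m j ∈ Ideal.span S := hspan ▸ Ideal.subset_span ⟨j, rfl⟩
  rw [he, monomial_mem_span_iff hS', ← he] at hmj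
  obtain ⟨p, hp, hpm⟩ := hmj
  obtain ⟨e', rfl⟩ := hS' p hp
  have hpI : monomial e' 1 ∈ Ideal.span (Set.range m) := hspan ▸ Ideal.subset_span hp
  rw [monomial_mem_span_iff (Set.forall_mem_range.2 hmon)] at hpI
  obtain ⟨_, ⟨i, rfl⟩, hmp⟩ := hpI
  obtain rfl := eq_of_dvd_of_span_image_ne (hmin j) (hmp.trans hpm)
  have hee' : e = e' := by
    rw [he, monomial_dvd_monomial] at hmp hpm
    exact le_antisymm (hmp.1.resolve_left one_ne_zero) (hpm.1.resolve_left one_ne_zero)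
  exact (hS _ hp).imp fun s hs => by rw [he, hee', hs]

theorem mem_hypergraphOf_prod_X_iff {v : Fin μ → Finset σ} {F : Finset (Fin μ)} :
    F ∈ hypergraphOf (fun j => ∏ a ∈ v j, (X a : MvPolynomial σ k)) ↔
      ∃ a, ∀ j, a ∈ v j ↔ j ∈ F := by
  simp only [hypergraphOf, Set.mem_ofPred_eq, X_dvd_prod_X_iff]

/-- The ideal with one variable `X t` for each member `p t` of a finite family of faces and one
generator for each vertex `j`, the product of the variables of the faces that contain `j`. -/
noncomputable def faceIdeal {τ : Type*} [Fintype τ] (p : τ → Finset (Fin μ)) (k : Type w)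
    [CommRing k] : Ideal (MvPolynomial τ k) :=
  Ideal.span (Set.range fun j => ∏ t with j ∈ p t, X t)

theorem IsAssociatedTo.exists_eq_map_faceIdeal {H : Set (Finset (Fin μ))} [Fintype ↥(H \ {∅})]
    {I : Ideal (MvPolynomial σ k)} (hI : IsAssociatedTo I H) :
    ∃ s : ↥(H \ {∅}) → Finset σ, Pairwise (Disjoint on s) ∧ (∀ F, (s F).Nonempty) ∧
      I = (faceIdeal Subtype.val k).map (blockHom s k) := by
  classical
  obtain ⟨hsq, m, hm, hH⟩ := hI
  choose v hv using hm.exists_eq_prod_X hsq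
  obtain rfl : m = fun j => ∏ a ∈ v j, X a := funext hv
  let face (a : σ) : Finset (Fin μ) := {j | a ∈ v j}
  have mem_face {a j} : j ∈ face a ↔ a ∈ v j := by simp [face]
  let s (F : ↥(H \ {∅})) : Finset σ := {a ∈ Finset.univ.biUnion v | face a = F}
  have mem_s {F a} : a ∈ s F ↔ face a = F := by
    refine Finset.mem_filter.trans (and_iff_right_of_imp fun h => ?_)
    obtain ⟨j, hj⟩ := Finset.nonempty_iff_ne_empty.2 F.2.2
    exact Finset.mem_biUnion.2 ⟨j, Finset.mem_univ j, mem_face.1 (h ▸ hj)⟩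
  have hs : Pairwise (Disjoint on s) := fun F F' hne => Finset.disjoint_left.2 fun a ha ha' =>
    hne (Subtype.ext ((mem_s.1 ha).symm.trans (mem_s.1 ha')))
  refine ⟨s, hs, fun F => ?_, ?_⟩
  · obtain ⟨a, ha⟩ := mem_hypergraphOf_prod_X_iff.1 (hH.ge F.2).1
    exact ⟨a, mem_s.2 (Finset.ext fun j => mem_face.trans (ha j))⟩
  · have hv' (j) : v j = ({F | j ∈ F.1} : Finset ↥(H \ {∅})).biUnion s := by
      ext a
      simp only [Finset.mem_biUnion, Finset.mem_filter, Finset.mem_univ, true_and, mem_s]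
      refine ⟨fun ha => ?_, fun ⟨_, hj, hF⟩ => mem_face.1 (hF ▸ hj)⟩
      have hj : j ∈ face a := mem_face.2 ha
      have hface : face a ∈ H \ {∅} := hH.le
        ⟨mem_hypergraphOf_prod_X_iff.2 ⟨a, fun _ => mem_face.symm⟩, Finset.ne_empty_of_mem hj⟩
      exact ⟨⟨face a, hface⟩, hj, rfl⟩
    rw [← hm.2.1, faceIdeal, Ideal.map_span, ← Set.range_comp]
    refine congrArg (fun m => Ideal.span (Set.range m)) (funext fun j => ?_)
    change _ = blockHom s k _
    rw [map_prod, hv', Finset.prod_biUnion (hs.set_pairwise _)]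
    simp only [blockHom_X]

theorem isAssociatedTo_faceIdeal {τ : Type*} [Fintype τ] {p : τ → Finset (Fin μ)}
    (hp : ∀ i j, i ≠ j → ∃ t, i ∈ p t ∧ j ∉ p t) :
    IsAssociatedTo (faceIdeal p k) (Set.range p) := by
  have hmon (j) : ∃ e, (∏ t with j ∈ p t, X t : MvPolynomial τ k) = monomial e 1 :=
    ⟨_, prod_X_eq_monomial _⟩
  refine ⟨⟨_, Set.forall_mem_range.2 fun j => ⟨_, rfl⟩, rfl⟩, _, ⟨hmon, rfl, fun j h => ?_⟩, ?_⟩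
  · obtain ⟨e, he⟩ := hmon j
    have hj : ∏ t with j ∈ p t, X t ∈ faceIdeal p k := Ideal.subset_span ⟨j, rfl⟩
    rw [← h, he, monomial_mem_span_iff (Set.forall_mem_image.2 fun i _ => hmon i), ← he] at hj
    obtain ⟨_, ⟨i, hij, rfl⟩, hdvd⟩ := hj
    obtain ⟨t, hit, hjt⟩ := hp i j hij
    have hX : (X t : MvPolynomial τ k) ∣ ∏ t with j ∈ p t, X t :=
      (X_dvd_prod_X_iff.2 (by simpa using hit)).trans hdvd
    exact hjt (by simpa using X_dvd_prod_X_iff.1 hX)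
  · congr 1
    ext F
    simp only [mem_hypergraphOf_prod_X_iff, Finset.mem_filter_univ, ← Finset.ext_iff,
      Set.mem_range]

theorem IsSeparatedHypergraph.exists_mem_notMem {H : Set (Finset (Fin μ))}
    (hH : IsSeparatedHypergraph H) {i j : Fin μ} (hij : i ≠ j) : ∃ F ∈ H, i ∈ F ∧ j ∉ F := by
  obtain h | h := hij.lt_or_gt
  · obtain ⟨F₁, hF₁, F₂, -, h₁, h₂⟩ := hH.2 i j h
    exact ⟨F₁, hF₁, h₁.1, h₂.2⟩
  · obtain ⟨F₁, -, F₂, hF₂, h₁, h₂⟩ := hH.2 j i h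
    exact ⟨F₂, hF₂, h₂.1, h₁.2⟩

variable (k) in
theorem IsSeparatedHypergraph.exists_isAssociatedTo {H : Set (Finset (Fin μ))}
    (hH : IsSeparatedHypergraph H) :
    ∃ (σ : Type u₁) (I : Ideal (MvPolynomial σ k)), IsAssociatedTo I H := by
  have := Fintype.ofFinite H
  let p (F : ULift.{u₁} H) : Finset (Fin μ) := F.down
  have hrange : Set.range p = H :=
    (ULift.down_surjective.range_comp Subtype.val).trans Subtype.range_val
  have hp (i j) (hij : i ≠ j) : ∃ F, i ∈ p F ∧ j ∉ p F :=
    let ⟨F, hF, h⟩ := hH.exists_mem_notMem hij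
    ⟨⟨F, hF⟩, h⟩
  exact ⟨_, _, hrange ▸ isAssociatedTo_faceIdeal (k := k) hp⟩

end AssociatedIdeals

section Invariants

variable {k : Type w} [Field k] {σ : Type u} {τ : Type} {s : τ → Finset σ}

theorem totalBetti_idealModule_map_blockHom (hs : Pairwise (Disjoint on s))
    (hne : ∀ t, (s t).Nonempty) (J : Ideal (MvPolynomial τ k)) (l : ℕ) :
    totalBetti l (idealModule (J.map (blockHom s k))) = totalBetti l (idealModule J) := by
  have hflat := (isFreeRingHom_blockHom (k := k) hs hne).flat
  obtain ⟨e⟩ := nonempty_extendScalars_ideal_iso hflat J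
  exact (totalBetti_congr e l).symm.trans
    (totalBetti_extendScalars hflat (constantCoeff_blockHom hne) _ l)

theorem totalBetti_quotientModule_map_blockHom (hs : Pairwise (Disjoint on s))
    (hne : ∀ t, (s t).Nonempty) (J : Ideal (MvPolynomial τ k)) (l : ℕ) :
    totalBetti l (quotientModule (J.map (blockHom s k))) = totalBetti l (quotientModule J) := by
  obtain ⟨e⟩ := nonempty_extendScalars_quotient_iso (f := (blockHom s k).toRingHom) J
  exact (totalBetti_congr e l).symm.trans (totalBetti_extendScalars
    (isFreeRingHom_blockHom hs hne).flat (constantCoeff_blockHom hne) _ l)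

theorem projectiveDimension_quotientModule_map_blockHom (hs : Pairwise (Disjoint on s))
    (hne : ∀ t, (s t).Nonempty) (J : Ideal (MvPolynomial τ k)) :
    projectiveDimension (quotientModule (J.map (blockHom s k))) =
      projectiveDimension (quotientModule J) := by
  have hfree := isFreeRingHom_blockHom (k := k) hs hne
  have := preservesHomology_extendScalars hfree.flat
  have := faithful_extendScalars hfree.faithfullyFlat
  obtain ⟨e⟩ := nonempty_extendScalars_quotient_iso (f := (blockHom s k).toRingHom) J
  exact (projectiveDimension_eq_of_iso e).symm.trans
    (projectiveDimension_obj _ (projective_of_projective_extendScalars hfree) _)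

end Invariants

theorem proposition2p2 (k : Type w) [Field k] {μ : ℕ}
    (H : Set (Finset (Fin μ))) (hH : IsSeparatedHypergraph H) :
    -- any two ideals associated to `H` have the same total Betti numbers
    -- and the same projective dimension
    (∀ (σ₁ : Type u₁) (σ₂ : Type u₂)
        (I₁ : Ideal (MvPolynomial σ₁ k)) (I₂ : Ideal (MvPolynomial σ₂ k)),
        IsAssociatedTo I₁ H → IsAssociatedTo I₂ H →
          (∀ l : ℕ, totalBetti l (idealModule I₁) = totalBetti l (idealModule I₂)) ∧
          (∀ l : ℕ, totalBetti l (quotientModule I₁) = totalBetti l (quotientModule I₂)) ∧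
          projectiveDimension (quotientModule I₁) = projectiveDimension (quotientModule I₂)) ∧
    -- hence `pd(H)` is well defined: there is exactly one value that is the projective
    -- dimension of `R / I` for every ideal `I` associated to `H`
    (∃! d : WithBot ℕ∞, ∀ (σ : Type u₁) (I : Ideal (MvPolynomial σ k)),
        IsAssociatedTo I H → projectiveDimension (quotientModule I) = d) := by
  have := Fintype.ofFinite ↥(H \ {∅})
  refine ⟨fun σ₁ σ₂ I₁ I₂ h₁ h₂ => ?_, ?_⟩
  · obtain ⟨s₁, hs₁, hne₁, rfl⟩ := h₁.exists_eq_map_faceIdeal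
    obtain ⟨s₂, hs₂, hne₂, rfl⟩ := h₂.exists_eq_map_faceIdeal
    refine ⟨fun l => ?_, fun l => ?_, ?_⟩
    · rw [totalBetti_idealModule_map_blockHom hs₁ hne₁,
        totalBetti_idealModule_map_blockHom hs₂ hne₂]
    · rw [totalBetti_quotientModule_map_blockHom hs₁ hne₁,
        totalBetti_quotientModule_map_blockHom hs₂ hne₂]
    · rw [projectiveDimension_quotientModule_map_blockHom hs₁ hne₁,
        projectiveDimension_quotientModule_map_blockHom hs₂ hne₂]
  · have hpd (σ : Type u₁) (I : Ideal (MvPolynomial σ k)) (hI : IsAssociatedTo I H) :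
        projectiveDimension (quotientModule I) =
          projectiveDimension (quotientModule (faceIdeal (Subtype.val : ↥(H \ {∅}) → _) k)) := by
      obtain ⟨s, hs, hne, rfl⟩ := hI.exists_eq_map_faceIdeal
      exact projectiveDimension_quotientModule_map_blockHom hs hne _
    obtain ⟨σ, I, hI⟩ := hH.exists_isAssociatedTo k
    exact ⟨_, hpd, fun d hd => (hd σ I hI).symm.trans (hpd σ I hI)⟩
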